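/- Work over $\mathbb{C}$. Regular functions on $GL_n$ are the elements of $\mathcal{O}(GL_n)=\mathbb{C}[x_{ij},1/\det]$; regular functions on a closed subgroup $G\subset GL_n$ are the restrictions of these, and they form $\mathcal O(G)$. Let $\mathfrak{g}$ be the Lie algebra of $G$, let $\mathfrak{t}$, $\mathfrak{n}_+$, $\mathfrak{n}_-$ be the sets of diagonal, strictly upper triangular and strictly lower triangular matrices in $\mathfrak{g}$, and suppose that $\mathfrak{g}=\mathfrak{n}_+\oplus\mathfrak{t}\oplus\mathfrak{n}_-$ and that the trace form $\langle X,Y\rangle=\mathrm{Tr}(XY)$ is non-degenerate on $\mathfrak{g}$. For $\xi=\xi_++\xi_0+\xi_-$ with $\xi_\pm\in\mathfrak{n}_\pm$, $\xi_0\in\mathfrak{t}$, put $r(\xi)=\xi_+-\xi_-$. The standard Poisson structure on $G$ is the bracket on $\mathcal{O}(G)$ given by $$\{f_1,f_2\}(g)=\tfrac12\Big(\langle r(g^{-1}\,\mathrm{grad} f_1(g)),\,g^{-1}\,\mathrm{grad} f_2(g)\rangle-\langle r(\mathrm{grad} f_1(g)\,g^{-1}),\,\mathrm{grad} f_2(g)\,g^{-1}\rangle\Big),$$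 where $\mathrm{grad} f(g)\in T_gG=g\mathfrak{g}$ is the gradient with respect to the bi-invariant metric $\langle U,V\rangle_g=\mathrm{Tr}(g^{-1}U\,g^{-1}V)$. **Proposition.** Let $\Omega$ be a non-degenerate, symmetric or skew-symmetric, anti-diagonal complex $n\times n$ matrix, let $\tau\colon GL_n\to GL_n$, $\tau(A)=\Omega A^{-t}\Omega^{-1}$, where $A^{-t}=(A^{-1})^t$, and let $G(\Omega)=\{A\in GL_n\mid A\Omega A^t=\Omega\}$. Then the standard Poisson structures on $GL_n$ and on $G(\Omega)$ are well defined (the decompositions above exist and are unique, so do the gradients of regular functions, and the brackets are Poisson brackets), and: 1. $\tau$ is a biregular involution of $GL_n$ that preserves the standard Poisson structure: $\{f_1\circ\tau,f_2\circ\tau\}=\{f_1,f_2\}\circ\tau$ for all $f_1,f_2\in\mathcal{O}(GL_n)$. 2. The fixed point set of $\tau$ is $G(\Omega)$, and the Poisson structure that $\tau$ induces on it is the standard Poisson structure of $G(\Omega)$. That is: the $\tau$-invariant regular functions $\mathcal{O}(GL_n)^\tau$ are closed under the bracket; those that vanish on $G(\Omega)$ form a Poisson ideal $\mathcal{I}^\tau$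 in $\mathcal{O}(GL_n)^\tau$; restriction maps $\mathcal{O}(GL_n)^\tau$ onto $\mathcal{O}(G(\Omega))$, so that $\mathcal{O}(G(\Omega))\cong\mathcal{O}(GL_n)^\tau/\mathcal{I}^\tau$; and the bracket of this quotient is the standard bracket, i.e. $\{f_1|_{G(\Omega)},f_2|_{G(\Omega)}\}_{G(\Omega)}=\{f_1,f_2\}_{GL_n}|_{G(\Omega)}$ for all $f_1,f_2\in\mathcal{O}(GL_n)^\tau$. -/

import Mathlib

open scoped MatrixGroups Matrix

noncomputable section

namespace StdPoisson

/-! ### Poisson brackets on algebras of functions, Poisson involutions, induced brackets -/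

section Generic

variable {X : Type*}

/-- Restriction of functions on `X` to a subset `Y`, as an algebra homomorphism. -/
def restrict (Y : Set X) : (X → ℂ) →ₐ[ℂ] (Y → ℂ) where
  toFun f := fun y => f y
  map_one' := rfl
  map_mul' _ _ := rfl
  map_zero' := rfl
  map_add' _ _ := rfl
  commutes' _ := rfl

/-- The operation `br` is a Poisson bracket on the algebra `A` of functions on `X`. -/
structure IsPoissonBracket (A : Subalgebra ℂ (X → ℂ))
    (br : (X → ℂ) → (X → ℂ) → (X → ℂ)) : Prop where
  mem : ∀ f ∈ A, ∀ g ∈ A, br f g ∈ A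
  add_left : ∀ f ∈ A, ∀ g ∈ A, ∀ h ∈ A, br (f + g) h = br f h + br g h
  smul_left : ∀ c : ℂ, ∀ f ∈ A, ∀ g ∈ A, br (c • f) g = c • br f g
  skew : ∀ f ∈ A, ∀ g ∈ A, br f g = -br g f
  leibniz : ∀ f ∈ A, ∀ g ∈ A, ∀ h ∈ A, br (f * g) h = f * br g h + br f h * g
  jacobi : ∀ f ∈ A, ∀ g ∈ A, ∀ h ∈ A, br f (br g h) + br g (br h f) + br h (br f g) = 0

/-- `τ` is a biregular involution of the variety `X` with coordinate ring `A`, and it preserves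
the bracket `br`. -/
structure IsPoissonInvolution (A : Subalgebra ℂ (X → ℂ))
    (br : (X → ℂ) → (X → ℂ) → (X → ℂ)) (τ : X → X) : Prop where
  involutive : Function.Involutive τ
  regular : ∀ f ∈ A, f ∘ τ ∈ A
  map_bracket : ∀ f ∈ A, ∀ g ∈ A, br (f ∘ τ) (g ∘ τ) = br f g ∘ τ

/-- The algebra of regular functions invariant under `τ`. -/
def invariants (A : Subalgebra ℂ (X → ℂ)) (τ : X → X) : Set (X → ℂ) :=
  {f | f ∈ A ∧ f ∘ τ = f}

/-- `Y` is the fixed point set of `τ`, and `brY` is the bracket induced on the coordinate ring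
`𝒪(Y) = A|_Y` by the bracket `br` on `A`: invariant functions are closed under `br`, those
vanishing on `Y` form a Poisson ideal among them, restriction identifies `𝒪(Y)` with the quotient
of the invariants by this ideal, and `brY` is the bracket of the quotient. -/
structure IsInducedBracket (A : Subalgebra ℂ (X → ℂ))
    (br : (X → ℂ) → (X → ℂ) → (X → ℂ)) (τ : X → X) (Y : Set X)
    (brY : (Y → ℂ) → (Y → ℂ) → (Y → ℂ)) : Prop where
  mem_iff_fixed : ∀ x, x ∈ Y ↔ τ x = x
  closed : ∀ f ∈ invariants A τ, ∀ g ∈ invariants A τ, br f g ∈ invariants A τ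
  ideal : ∀ f ∈ invariants A τ, ∀ g ∈ invariants A τ, restrict Y f = 0 →
    restrict Y (br f g) = 0 ∧ restrict Y (br g f) = 0
  surj : ∀ φ ∈ A.map (restrict Y), ∃ f ∈ invariants A τ, restrict Y f = φ
  bracket_eq : ∀ f ∈ invariants A τ, ∀ g ∈ invariants A τ,
    brY (restrict Y f) (restrict Y g) = restrict Y (br f g)

/-- The induced bracket on `𝒪(Y)` is unique. -/
theorem IsInducedBracket.unique {A : Subalgebra ℂ (X → ℂ)}
    {br : (X → ℂ) → (X → ℂ) → (X → ℂ)} {τ : X → X} {Y : Set X}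
    {b₁ b₂ : (Y → ℂ) → (Y → ℂ) → (Y → ℂ)}
    (h₁ : IsInducedBracket A br τ Y b₁) (h₂ : IsInducedBracket A br τ Y b₂)
    (φ ψ : Y → ℂ) (hφ : φ ∈ A.map (restrict Y)) (hψ : ψ ∈ A.map (restrict Y)) :
    b₁ φ ψ = b₂ φ ψ := by
  obtain ⟨f, hf, rfl⟩ := h₁.surj φ hφ
  obtain ⟨g, hg, rfl⟩ := h₁.surj ψ hψ
  rw [h₁.bracket_eq f hf g hg, h₂.bracket_eq f hf g hg]

end Generic

/-! ### The standard bracket of a matrix group -/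

section Std

variable {n : ℕ}

/-- The coordinate ring `ℂ[x_ij, 1/det]` of `GL_n`. -/
def regularGL (n : ℕ) : Subalgebra ℂ (GL (Fin n) ℂ → ℂ) :=
  Algebra.adjoin ℂ
    (Set.range (fun (p : Fin n × Fin n) (A : GL (Fin n) ℂ) => (A : Matrix (Fin n) (Fin n) ℂ) p.1 p.2)
      ∪ {fun A : GL (Fin n) ℂ => ((A : Matrix (Fin n) (Fin n) ℂ).det)⁻¹})

/-- The regular functions on a subgroup `G`: restrictions of regular functions on `GL_n`. -/
def regularOn (G : Subgroup (GL (Fin n) ℂ)) : Subalgebra ℂ (G → ℂ) :=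
  (regularGL n).map (restrict (G : Set (GL (Fin n) ℂ)))

/-- The matrix exponential as an invertible matrix. -/
def expGL (X : Matrix (Fin n) (Fin n) ℂ) : GL (Fin n) ℂ := (Matrix.isUnit_exp X).unit

/-- The Lie algebra of a (closed, complex) matrix group. -/
def lieAlg (G : Subgroup (GL (Fin n) ℂ)) : Set (Matrix (Fin n) (Fin n) ℂ) :=
  {X | ∀ t : ℂ, expGL (t • X) ∈ G}

/-- The Cartan subalgebra: diagonal matrices in the Lie algebra. -/
def cartan (G : Subgroup (GL (Fin n) ℂ)) : Set (Matrix (Fin n) (Fin n) ℂ) :=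
  {X | X ∈ lieAlg G ∧ ∀ i j, i ≠ j → X i j = 0}

/-- The positive nilpotent subalgebra: strictly upper triangular matrices in the Lie algebra. -/
def nilPos (G : Subgroup (GL (Fin n) ℂ)) : Set (Matrix (Fin n) (Fin n) ℂ) :=
  {X | X ∈ lieAlg G ∧ ∀ i j, j ≤ i → X i j = 0}

/-- The negative nilpotent subalgebra: strictly lower triangular matrices in the Lie algebra. -/
def nilNeg (G : Subgroup (GL (Fin n) ℂ)) : Set (Matrix (Fin n) (Fin n) ℂ) :=
  {X | X ∈ lieAlg G ∧ ∀ i j, i ≤ j → X i j = 0}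

/-- `p = (ξ₊, ξ₀, ξ₋)` is a triangular decomposition of `ξ` inside the Lie algebra of `G`. -/
def IsTriangular (G : Subgroup (GL (Fin n) ℂ)) (ξ : Matrix (Fin n) (Fin n) ℂ)
    (p : Matrix (Fin n) (Fin n) ℂ × Matrix (Fin n) (Fin n) ℂ × Matrix (Fin n) (Fin n) ℂ) : Prop :=
  p.1 ∈ nilPos G ∧ p.2.1 ∈ cartan G ∧ p.2.2 ∈ nilNeg G ∧ ξ = p.1 + p.2.1 + p.2.2

open Classical in
/-- The standard `r`-matrix `r(ξ) = ξ₊ - ξ₋` (zero if `ξ` has no triangular decomposition). -/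
def rMatrix (G : Subgroup (GL (Fin n) ℂ)) (ξ : Matrix (Fin n) (Fin n) ℂ) :
    Matrix (Fin n) (Fin n) ℂ :=
  if h : ∃ p, IsTriangular G ξ p then h.choose.1 - h.choose.2.2 else 0

/-- The bi-invariant metric on `GL_n` that equals the trace form at the identity. -/
def metric (g : GL (Fin n) ℂ) (U V : Matrix (Fin n) (Fin n) ℂ) : ℂ :=
  Matrix.trace ((((g⁻¹ : GL (Fin n) ℂ) : Matrix (Fin n) (Fin n) ℂ) * U) *
    (((g⁻¹ : GL (Fin n) ℂ) : Matrix (Fin n) (Fin n) ℂ) * V))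

/-- The derivative of a function `f` on `G` at `g` along the tangent vector `g Z`. -/
def diff {G : Subgroup (GL (Fin n) ℂ)} (f : G → ℂ) (g : G) (Z : lieAlg G) : ℂ :=
  deriv (fun t : ℂ => f (g * ⟨expGL (t • (Z : Matrix (Fin n) (Fin n) ℂ)), Z.2 t⟩)) 0

/-- `U` is the gradient of `f` at `g`: it lies in the tangent space `T_g G = g 𝔤`, and pairing
with it by the bi-invariant metric gives the differential of `f`. -/
def IsGradient {G : Subgroup (GL (Fin n) ℂ)} (f : G → ℂ) (g : G)
    (U : Matrix (Fin n) (Fin n) ℂ) : Prop :=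
  (((g : GL (Fin n) ℂ)⁻¹ : GL (Fin n) ℂ) : Matrix (Fin n) (Fin n) ℂ) * U ∈ lieAlg G ∧
    ∀ Z : lieAlg G,
      metric (g : GL (Fin n) ℂ) U (((g : GL (Fin n) ℂ) : Matrix (Fin n) (Fin n) ℂ) * Z) = diff f g Z

open Classical in
/-- The gradient (zero if there is none). -/
def grad {G : Subgroup (GL (Fin n) ℂ)} (f : G → ℂ) (g : G) : Matrix (Fin n) (Fin n) ℂ :=
  if h : ∃ U, IsGradient f g U then h.choose else 0

/-- The triangular decompositions and the gradients in the standard bracket of `G` exist and are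
unique. -/
structure HasStandardData (G : Subgroup (GL (Fin n) ℂ)) : Prop where
  triangular : ∀ ξ ∈ lieAlg G, ∃! p, IsTriangular G ξ p
  gradient : ∀ f ∈ regularOn G, ∀ g : G, ∃! U, IsGradient f g U

/-- The standard Poisson bracket of a matrix group `G`. -/
def stdBracket (G : Subgroup (GL (Fin n) ℂ)) (f₁ f₂ : G → ℂ) : G → ℂ := fun g =>
  let gi : Matrix (Fin n) (Fin n) ℂ := (((g : GL (Fin n) ℂ)⁻¹ : GL (Fin n) ℂ) : Matrix _ _ ℂ)
  (1 / 2 : ℂ) *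
    (Matrix.trace (rMatrix G (gi * grad f₁ g) * (gi * grad f₂ g)) -
      Matrix.trace (rMatrix G (grad f₁ g * gi) * (grad f₂ g * gi)))

/-- The standard Poisson bracket of `GL_n`, on functions on `GL_n` itself. -/
def stdBracketGL (n : ℕ) (f₁ f₂ : GL (Fin n) ℂ → ℂ) : GL (Fin n) ℂ → ℂ := fun A =>
  stdBracket (⊤ : Subgroup (GL (Fin n) ℂ)) (fun B => f₁ B) (fun B => f₂ B) ⟨A, Subgroup.mem_top A⟩

/-- The transpose of an invertible matrix. -/
def transposeGL (A : GL (Fin n) ℂ) : GL (Fin n) ℂ where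
  val := (A : Matrix (Fin n) (Fin n) ℂ)ᵀ
  inv := ((A⁻¹ : GL (Fin n) ℂ) : Matrix (Fin n) (Fin n) ℂ)ᵀ
  val_inv := by rw [← Matrix.transpose_mul, Units.inv_mul, Matrix.transpose_one]
  inv_val := by rw [← Matrix.transpose_mul, Units.mul_inv, Matrix.transpose_one]

/-- The map `τ(A) = Ω A⁻ᵗ Ω⁻¹`. -/
def tau (Ω A : GL (Fin n) ℂ) : GL (Fin n) ℂ := Ω * transposeGL A⁻¹ * Ω⁻¹

theorem transposeGL_mul (A B : GL (Fin n) ℂ) :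
    transposeGL (A * B) = transposeGL B * transposeGL A :=
  Units.ext (Matrix.transpose_mul _ _)

theorem transposeGL_one : transposeGL (1 : GL (Fin n) ℂ) = 1 :=
  Units.ext Matrix.transpose_one

/-- The group `G(Ω) = {A | A Ω Aᵗ = Ω}`. -/
def formGroup (Ω : GL (Fin n) ℂ) : Subgroup (GL (Fin n) ℂ) where
  carrier := {A | A * Ω * transposeGL A = Ω}
  one_mem' := by simp [transposeGL_one]
  mul_mem' := by
    intro A B hA hB
    change A * Ω * transposeGL A = Ω at hA
    change B * Ω * transposeGL B = Ω at hB
    change A * B * Ω * transposeGL (A * B) = Ω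
    calc A * B * Ω * transposeGL (A * B)
        = A * (B * Ω * transposeGL B) * transposeGL A := by
          rw [transposeGL_mul]; simp only [mul_assoc]
      _ = Ω := by rw [hB, hA]
  inv_mem' := by
    intro A hA
    change A * Ω * transposeGL A = Ω at hA
    change A⁻¹ * Ω * transposeGL A⁻¹ = Ω
    have h : transposeGL A * transposeGL A⁻¹ = 1 := by
      rw [← transposeGL_mul, inv_mul_cancel, transposeGL_one]
    calc A⁻¹ * Ω * transposeGL A⁻¹
        = A⁻¹ * (A * Ω * transposeGL A) * transposeGL A⁻¹ := by rw [hA]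
      _ = Ω * (transposeGL A * transposeGL A⁻¹) := by group
      _ = Ω := by rw [h, mul_one]

end Std

end StdPoisson

end

noncomputable section

namespace StdPoisson

variable {n : ℕ}

/-! Identify the differential of $f$ at $g$ with the matrix $L$ satisfying
$\frac{d}{dt}f(ge^{tX})|_{t=0}=\mathrm{Tr}(LX)$ (`HasLogGrad`). The bracket of $GL_n$ is then
`bivector` evaluated on two such $L$, and everything reduces to linear algebra with $\theta=d\tau$,
$\theta(X)=-\Omega X^t\Omega^{-1}$.

The map $\theta$ is an isometric involution for the trace form. Because $\Omega$ is anti-diagonal,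
$\theta$ preserves the three triangular parts, hence commutes with $r$ (`glR_theta`). As $\tau$
replaces $L$ by $\theta L$ and $\mathrm{Ad}_{\tau(g)}\theta=\theta\,\mathrm{Ad}_g$, it is Poisson.
The Lie algebra of $G(\Omega)$ is the fixed space of $\theta$: it inherits the triangular
decomposition, and averaging over $\theta$ is the orthogonal projection onto it, so gradients on
$G(\Omega)$ are projected gradients of $GL_n$. For $\tau$-invariant $f$ at a fixed point, $\theta
L=L$; the projection does nothing and the two brackets agree (`stdBracket_formGroup_restrict`).

The Jacobi identity on $GL_n$ is reduced to coordinate functions, where the bracket is quadratic,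
and rests on an identity for signs (`ordSign_cyclic`). On $G(\Omega)$ it is inherited from the
invariant functions. -/

@[simp]
theorem expGL_zero : expGL (0 : Matrix (Fin n) (Fin n) ℂ) = 1 :=
  Units.ext NormedSpace.exp_zero

theorem expGL_conj (g : GL (Fin n) ℂ) (X : Matrix (Fin n) (Fin n) ℂ) :
    expGL ((g : Matrix (Fin n) (Fin n) ℂ) * X * ((g⁻¹ : GL (Fin n) ℂ) : Matrix (Fin n) (Fin n) ℂ)) =
      g * expGL X * g⁻¹ :=
  Units.ext (Matrix.exp_units_conj g X)

theorem expGL_transpose (X : Matrix (Fin n) (Fin n) ℂ) :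
    expGL Xᵀ = transposeGL (expGL X) :=
  Units.ext (Matrix.exp_transpose X)

theorem expGL_neg (X : Matrix (Fin n) (Fin n) ℂ) : expGL (-X) = (expGL X)⁻¹ :=
  Units.ext (by rw [Matrix.coe_units_inv]; exact Matrix.exp_neg X)

section
open scoped Matrix.Norms.Operator

/-- Stated entry by entry, so that the matrix norm needed to differentiate the exponential stays
local to this section. -/
theorem hasDerivAt_exp_smul_apply (X : Matrix (Fin n) (Fin n) ℂ) (i j : Fin n) :
    HasDerivAt (fun t : ℂ => NormedSpace.exp (t • X) i j) (X i j) 0 := by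
  have h := hasDerivAt_exp_smul_const (𝕂 := ℂ) X 0
  rw [zero_smul, NormedSpace.exp_zero, one_mul] at h
  exact ((Matrix.entryLinearMap ℂ ℂ i j).toContinuousLinearMap.hasFDerivAt).comp_hasDerivAt (0 : ℂ) h

end

/-! ### Regular functions on $GL_n$ -/

/-- The coordinate function `x_ij` on `GL_n`. -/
def coord (i j : Fin n) : GL (Fin n) ℂ → ℂ := fun A => (A : Matrix (Fin n) (Fin n) ℂ) i j

/-- The determinant as a function on `GL_n`. -/
def detFun (n : ℕ) : GL (Fin n) ℂ → ℂ := fun A => (A : Matrix (Fin n) (Fin n) ℂ).det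

theorem detFun_ne_zero (g : GL (Fin n) ℂ) : detFun n g ≠ 0 :=
  ((Matrix.isUnit_iff_isUnit_det _).mp g.isUnit).ne_zero

theorem coord_mem (i j : Fin n) : coord i j ∈ regularGL n :=
  Algebra.subset_adjoin (Or.inl ⟨(i, j), rfl⟩)

theorem inv_detFun_mem : (detFun n)⁻¹ ∈ regularGL n :=
  Algebra.subset_adjoin (Or.inr rfl)

/-- A determinant of functions in a subalgebra lies in the subalgebra. -/
theorem det_mem_subalgebra {X : Type*} (A : Subalgebra ℂ (X → ℂ))
    (M : X → Matrix (Fin n) (Fin n) ℂ) (hM : ∀ i j, (fun x => M x i j) ∈ A) :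
    (fun x => (M x).det) ∈ A := by
  have h : (fun x => (M x).det) =
      ∑ σ : Equiv.Perm (Fin n), (Equiv.Perm.sign σ : ℤ) • ∏ i, fun x => M x (σ i) i := by
    funext x
    simp [Matrix.det_apply, Finset.sum_apply, Finset.prod_apply, Units.smul_def]
  rw [h]
  exact sum_mem fun σ _ => zsmul_mem (prod_mem fun i _ => hM _ _) _

theorem detFun_mem_adjoin :
    detFun n ∈ Algebra.adjoin ℂ (Set.range fun p : Fin n × Fin n => coord p.1 p.2) :=
  det_mem_subalgebra _ _ fun i j => Algebra.subset_adjoin ⟨(i, j), rfl⟩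

theorem adjoin_coord_le :
    Algebra.adjoin ℂ (Set.range fun p : Fin n × Fin n => coord p.1 p.2) ≤ regularGL n :=
  Algebra.adjoin_mono Set.subset_union_left

theorem detFun_mem : detFun n ∈ regularGL n := adjoin_coord_le detFun_mem_adjoin

/-- Induction on regular functions on `GL_n`. -/
theorem regularGL_induction {p : (GL (Fin n) ℂ → ℂ) → Prop}
    (hcoord : ∀ i j, p (coord i j))
    (hinv : p (detFun n) → p (detFun n)⁻¹)
    (hconst : ∀ c : ℂ, p (algebraMap ℂ _ c))
    (hadd : ∀ f ∈ regularGL n, ∀ g ∈ regularGL n, p f → p g → p (f + g))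
    (hmul : ∀ f ∈ regularGL n, ∀ g ∈ regularGL n, p f → p g → p (f * g))
    {f : GL (Fin n) ℂ → ℂ} (hf : f ∈ regularGL n) : p f := by
  -- The inverse of the determinant is a generator, but the determinant is only a polynomial in the
  -- $x_{ij}$; it needs its own induction before `hinv` applies.
  have hdet : p (detFun n) := by
    refine Algebra.adjoin_induction (p := fun f _ => p f) ?_ hconst ?_ ?_ detFun_mem_adjoin
    · rintro _ ⟨q, rfl⟩
      exact hcoord _ _
    · exact fun x y hx hy => hadd x (adjoin_coord_le hx) y (adjoin_coord_le hy)
    · exact fun x y hx hy => hmul x (adjoin_coord_le hx) y (adjoin_coord_le hy)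
  refine Algebra.adjoin_induction (p := fun f _ => p f) ?_ hconst
    (fun x y hx hy => hadd x hx y hy) (fun x y hx hy => hmul x hx y hy) hf
  rintro _ (⟨q, rfl⟩ | rfl)
  · exact hcoord _ _
  · exact hinv hdet

/-! ### Logarithmic gradients -/

/-- `L` is the left logarithmic gradient of `f` at `g`: the derivative of `f` along `g X` is
`Tr (L X)`. -/
def HasLogGrad (f : GL (Fin n) ℂ → ℂ) (g : GL (Fin n) ℂ) (L : Matrix (Fin n) (Fin n) ℂ) : Prop :=
  ∀ X : Matrix (Fin n) (Fin n) ℂ,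
    HasDerivAt (fun t : ℂ => f (g * expGL (t • X))) (Matrix.trace (L * X)) 0

namespace HasLogGrad

variable {f f' : GL (Fin n) ℂ → ℂ} {g : GL (Fin n) ℂ} {L L' : Matrix (Fin n) (Fin n) ℂ}

theorem unique (h : HasLogGrad f g L) (h' : HasLogGrad f g L') : L = L' :=
  Matrix.ext_iff_trace_mul_right.mpr fun X => (h X).unique (h' X)

theorem const (c : ℂ) : HasLogGrad (algebraMap ℂ (GL (Fin n) ℂ → ℂ) c) g 0 := fun X => by
  simpa using hasDerivAt_const (0 : ℂ) c

theorem add (h : HasLogGrad f g L) (h' : HasLogGrad f' g L') : HasLogGrad (f + f') g (L + L') :=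
  fun X => by
    rw [add_mul, Matrix.trace_add]
    exact (h X).add (h' X)

theorem mul (h : HasLogGrad f g L) (h' : HasLogGrad f' g L') :
    HasLogGrad (f * f') g (f g • L' + f' g • L) := fun X => by
  have := (h X).mul (h' X)
  rw [zero_smul, expGL_zero, mul_one] at this
  rw [add_mul, Matrix.trace_add, smul_mul_assoc, smul_mul_assoc, Matrix.trace_smul,
    Matrix.trace_smul, smul_eq_mul, smul_eq_mul, add_comm, mul_comm (f' g)]
  exact this

theorem inv (h : HasLogGrad f g L) (hg : f g ≠ 0) :
    HasLogGrad f⁻¹ g (-((f g ^ 2)⁻¹) • L) := fun X => by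
  have := (h X).inv (by simpa using hg)
  rw [zero_smul, expGL_zero, mul_one] at this
  rw [smul_mul_assoc, Matrix.trace_smul, smul_eq_mul]
  exact this.congr_deriv (by ring)

/-- The derivative of $x_{ij}$ along $gX$ is $(gX)_{ij}=\mathrm{Tr}(E_{ji}gX)$. -/
theorem coord (i j : Fin n) :
    HasLogGrad (coord i j) g (Matrix.single j i 1 * (g : Matrix (Fin n) (Fin n) ℂ)) := fun X => by
  have h : Matrix.trace (Matrix.single j i 1 * (g : Matrix (Fin n) (Fin n) ℂ) * X) =
      ∑ k, (g : Matrix (Fin n) (Fin n) ℂ) i k * X k j := by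
    rw [Matrix.mul_assoc, Matrix.trace_mul_comm, Matrix.trace_mul_single]
    simp [Matrix.mul_apply]
  rw [h]
  have := HasDerivAt.fun_sum (u := Finset.univ) fun (k : Fin n) _ =>
    (hasDerivAt_exp_smul_apply X k j).const_mul ((g : Matrix (Fin n) (Fin n) ℂ) i k)
  exact this

end HasLogGrad

theorem exists_hasLogGrad {f : GL (Fin n) ℂ → ℂ} (hf : f ∈ regularGL n) (g : GL (Fin n) ℂ) :
    ∃ L, HasLogGrad f g L := by
  refine regularGL_induction (p := fun f => ∃ L, HasLogGrad f g L) ?_ ?_ ?_ ?_ ?_ hf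
  · exact fun i j => ⟨_, HasLogGrad.coord i j⟩
  · exact fun ⟨L, h⟩ => ⟨_, h.inv (detFun_ne_zero g)⟩
  · exact fun c => ⟨_, HasLogGrad.const c⟩
  · exact fun _ _ _ _ ⟨_, h⟩ ⟨_, h'⟩ => ⟨_, h.add h'⟩
  · exact fun _ _ _ _ ⟨_, h⟩ ⟨_, h'⟩ => ⟨_, h.mul h'⟩

/-! ### Triangular parts, the $r$-matrix and the bivector -/

/-- The `r`-matrix of `𝔤𝔩_n`. -/
def glR : Matrix (Fin n) (Fin n) ℂ →ₗ[ℂ] Matrix (Fin n) (Fin n) ℂ where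
  toFun X := Matrix.of fun i j => (if i < j then 1 else if j < i then -1 else 0) * X i j
  map_add' X Y := by ext; simp [mul_add]
  map_smul' c X := by ext; simp [mul_left_comm]

/-- The upper triangular, diagonal and lower triangular parts of a matrix. -/
def triParts (X : Matrix (Fin n) (Fin n) ℂ) :
    Matrix (Fin n) (Fin n) ℂ × Matrix (Fin n) (Fin n) ℂ × Matrix (Fin n) (Fin n) ℂ :=
  (Matrix.of fun i j => if i < j then X i j else 0,
    Matrix.of fun i j => if i = j then X i j else 0,
    Matrix.of fun i j => if j < i then X i j else 0)

theorem triParts_sum (X : Matrix (Fin n) (Fin n) ℂ) :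
    X = (triParts X).1 + (triParts X).2.1 + (triParts X).2.2 := by
  ext i j
  rcases lt_trichotomy i j with h | h | h
  · simp [triParts, h, h.ne, h.not_gt]
  · simp [triParts, h]
  · simp [triParts, h, h.ne', h.not_gt]

theorem triParts_sub (X : Matrix (Fin n) (Fin n) ℂ) :
    (triParts X).1 - (triParts X).2.2 = glR X := by
  ext i j
  rcases lt_trichotomy i j with h | h | h
  · simp [triParts, glR, h, h.not_gt]
  · simp [triParts, glR, h]
  · simp [triParts, glR, h, h.not_gt]

/-- The three supports are disjoint, so the entries force the decomposition whatever $G$ is; the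
choice made in `rMatrix` is therefore harmless. -/
theorem IsTriangular.eq_triParts {G : Subgroup (GL (Fin n) ℂ)} {X : Matrix (Fin n) (Fin n) ℂ}
    {p : Matrix (Fin n) (Fin n) ℂ × Matrix (Fin n) (Fin n) ℂ × Matrix (Fin n) (Fin n) ℂ}
    (hp : IsTriangular G X p) : p = triParts X := by
  obtain ⟨P, D, N⟩ := p
  obtain ⟨⟨-, hP⟩, ⟨-, hD⟩, ⟨-, hN⟩, rfl⟩ := hp
  simp only at hP hD hN
  refine Prod.ext ?_ (Prod.ext ?_ ?_) <;> ext i j <;>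
    rcases lt_trichotomy i j with h | h | h
  · simp [triParts, h, hD i j h.ne, hN i j h.le]
  · simp [triParts, h, hP]
  · simp [triParts, h.not_gt, hP i j h.le]
  · simp [triParts, h.ne, hD i j h.ne]
  · simp [triParts, h, hP, hN]
  · simp [triParts, h.ne', hD i j h.ne']
  · simp [triParts, h.not_gt, hN i j h.le]
  · simp [triParts, h, hN]
  · simp [triParts, h, hD i j h.ne', hP i j h.le]

/-- The trace is $\sum_{i,j}\mathrm{sgn}(j-i)X_{ij}Y_{ji}$, and the sign is antisymmetric. -/
theorem trace_glR_mul (X Y : Matrix (Fin n) (Fin n) ℂ) :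
    Matrix.trace (glR X * Y) = -Matrix.trace (glR Y * X) := by
  simp only [Matrix.trace, Matrix.diag, Matrix.mul_apply, glR, LinearMap.coe_mk, AddHom.coe_mk,
    Matrix.of_apply, ← Finset.sum_neg_distrib]
  rw [Finset.sum_comm]
  refine Finset.sum_congr rfl fun i _ => Finset.sum_congr rfl fun j _ => ?_
  rcases lt_trichotomy i j with h | h | h
  · simp [h, h.not_gt]; ring
  · simp [h]
  · simp [h, h.not_gt]; ring

/-- Conjugation of matrices by an invertible matrix. -/
def conjGL (g : GL (Fin n) ℂ) : Matrix (Fin n) (Fin n) ℂ →ₗ[ℂ] Matrix (Fin n) (Fin n) ℂ where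
  toFun X := (g : Matrix (Fin n) (Fin n) ℂ) * X * ((g⁻¹ : GL (Fin n) ℂ) : Matrix (Fin n) (Fin n) ℂ)
  map_add' X Y := by rw [mul_add, add_mul]
  map_smul' c X := by rw [mul_smul_comm, smul_mul_assoc, RingHom.id_apply]

theorem conjGL_apply (g : GL (Fin n) ℂ) (X : Matrix (Fin n) (Fin n) ℂ) :
    conjGL g X = (g : Matrix (Fin n) (Fin n) ℂ) * X *
      ((g⁻¹ : GL (Fin n) ℂ) : Matrix (Fin n) (Fin n) ℂ) := rfl

theorem conjGL_mem_lieAlg {G : Subgroup (GL (Fin n) ℂ)} {g : GL (Fin n) ℂ} (hg : g ∈ G)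
    {X : Matrix (Fin n) (Fin n) ℂ} (hX : X ∈ lieAlg G) : conjGL g X ∈ lieAlg G := fun t => by
  rw [← map_smul, conjGL_apply, expGL_conj]
  exact G.mul_mem (G.mul_mem hg (hX t)) (G.inv_mem hg)

/-- The standard bivector of `GL_n` at `g`, in the left trivialization. -/
def bivector (g : GL (Fin n) ℂ) (X Y : Matrix (Fin n) (Fin n) ℂ) : ℂ :=
  (1 / 2 : ℂ) * (Matrix.trace (glR X * Y) - Matrix.trace (glR (conjGL g X) * conjGL g Y))

theorem bivector_skew (g : GL (Fin n) ℂ) (X Y : Matrix (Fin n) (Fin n) ℂ) :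
    bivector g X Y = -bivector g Y X := by
  rw [bivector, bivector, trace_glR_mul X, trace_glR_mul (conjGL g X)]
  ring

theorem bivector_add_left (g : GL (Fin n) ℂ) (X X' Y : Matrix (Fin n) (Fin n) ℂ) :
    bivector g (X + X') Y = bivector g X Y + bivector g X' Y := by
  simp only [bivector, map_add, add_mul, Matrix.trace_add]
  ring

theorem bivector_smul_left (g : GL (Fin n) ℂ) (c : ℂ) (X Y : Matrix (Fin n) (Fin n) ℂ) :
    bivector g (c • X) Y = c * bivector g X Y := by
  simp only [bivector, map_smul, smul_mul_assoc, Matrix.trace_smul, smul_eq_mul]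
  ring

/-! ### Groups whose Lie algebra is fixed by an involution -/

/-- The Lie algebra of `G` is the fixed point set of an involution `θ` of `𝔤𝔩_n` that preserves
the trace form and the triangular decomposition. -/
structure IsFixedBy (G : Subgroup (GL (Fin n) ℂ))
    (θ : Matrix (Fin n) (Fin n) ℂ →ₗ[ℂ] Matrix (Fin n) (Fin n) ℂ) : Prop where
  mem_lieAlg : ∀ X, X ∈ lieAlg G ↔ θ X = X
  involutive : ∀ X, θ (θ X) = X
  trace_mul : ∀ X Y, Matrix.trace (θ X * θ Y) = Matrix.trace (X * Y)
  triParts : ∀ X, triParts (θ X) = Prod.map θ (Prod.map θ θ) (triParts X)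

/-- The average of `X` and `θ X`. -/
def average (θ : Matrix (Fin n) (Fin n) ℂ →ₗ[ℂ] Matrix (Fin n) (Fin n) ℂ)
    (X : Matrix (Fin n) (Fin n) ℂ) : Matrix (Fin n) (Fin n) ℂ :=
  (1 / 2 : ℂ) • (X + θ X)

theorem average_of_fixed {θ : Matrix (Fin n) (Fin n) ℂ →ₗ[ℂ] Matrix (Fin n) (Fin n) ℂ}
    {X : Matrix (Fin n) (Fin n) ℂ} (h : θ X = X) : average θ X = X := by
  rw [average, h, ← two_smul ℂ X, smul_smul]
  norm_num

namespace IsFixedBy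

variable {G : Subgroup (GL (Fin n) ℂ)}
  {θ : Matrix (Fin n) (Fin n) ℂ →ₗ[ℂ] Matrix (Fin n) (Fin n) ℂ}

theorem isTriangular_triParts (h : IsFixedBy G θ) {X : Matrix (Fin n) (Fin n) ℂ}
    (hX : X ∈ lieAlg G) : IsTriangular G X (StdPoisson.triParts X) := by
  have hp := h.triParts X
  rw [(h.mem_lieAlg X).mp hX] at hp
  refine ⟨⟨?_, ?_⟩, ⟨?_, ?_⟩, ⟨?_, ?_⟩, triParts_sum X⟩
  · rw [h.mem_lieAlg]; exact (congrArg Prod.fst hp).symm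
  · intro i j hij; simp [StdPoisson.triParts, hij]
  · rw [h.mem_lieAlg]; exact (congrArg (fun p => p.2.1) hp).symm
  · intro i j hij; simp [StdPoisson.triParts, hij]
  · rw [h.mem_lieAlg]; exact (congrArg (fun p => p.2.2) hp).symm
  · intro i j hij; simp [StdPoisson.triParts, hij]

theorem rMatrix_eq (h : IsFixedBy G θ) {X : Matrix (Fin n) (Fin n) ℂ}
    (hX : X ∈ lieAlg G) : rMatrix G X = glR X := by
  have hex : ∃ p, IsTriangular G X p := ⟨_, h.isTriangular_triParts hX⟩
  rw [rMatrix, dif_pos hex, hex.choose_spec.eq_triParts, triParts_sub]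

theorem average_mem (h : IsFixedBy G θ) (X : Matrix (Fin n) (Fin n) ℂ) :
    average θ X ∈ lieAlg G := by
  rw [h.mem_lieAlg, average, map_smul, map_add, h.involutive, add_comm]

/-- Since $\theta$ is isometric and fixes $Z$, $\mathrm{Tr}(\theta X\cdot Z)=\mathrm{Tr}(XZ)$:
averaging is the orthogonal projection onto the Lie algebra. -/
theorem trace_average_mul (h : IsFixedBy G θ) (X : Matrix (Fin n) (Fin n) ℂ)
    {Z : Matrix (Fin n) (Fin n) ℂ} (hZ : Z ∈ lieAlg G) :
    Matrix.trace (average θ X * Z) = Matrix.trace (X * Z) := by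
  have : Matrix.trace (θ X * Z) = Matrix.trace (X * Z) := by
    conv_lhs => rw [← (h.mem_lieAlg Z).mp hZ]
    exact h.trace_mul X Z
  rw [average, smul_mul_assoc, add_mul, Matrix.trace_smul, Matrix.trace_add, this, smul_eq_mul]
  ring

/-- The trace form is non-degenerate on the Lie algebra. -/
theorem eq_of_trace_mul (h : IsFixedBy G θ) {X Y : Matrix (Fin n) (Fin n) ℂ}
    (hX : X ∈ lieAlg G) (hY : Y ∈ lieAlg G)
    (hXY : ∀ Z ∈ lieAlg G, Matrix.trace (X * Z) = Matrix.trace (Y * Z)) : X = Y := by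
  -- Pairing with an element of the Lie algebra sees only the average of the test matrix $W$, so
  -- non-degeneracy descends from $\mathfrak{gl}_n$.
  refine Matrix.ext_iff_trace_mul_left.mpr fun W => ?_
  rw [← h.trace_average_mul W hX, ← h.trace_average_mul W hY, Matrix.trace_mul_comm,
    hXY _ (h.average_mem W), Matrix.trace_mul_comm]

theorem diff_restrict {f : GL (Fin n) ℂ → ℂ} {g : G} {L : Matrix (Fin n) (Fin n) ℂ}
    (hL : HasLogGrad f g L) (Z : lieAlg G) :
    diff (fun x : G => f x) g Z = Matrix.trace (L * (Z : Matrix (Fin n) (Fin n) ℂ)) :=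
  (hL Z).deriv

/-- On the Lie algebra the functional $Z\mapsto\mathrm{Tr}(LZ)$ is represented by the projection of
$L$, and by nothing else there. -/
theorem isGradient_iff (h : IsFixedBy G θ) {f : GL (Fin n) ℂ → ℂ} {g : G}
    {L : Matrix (Fin n) (Fin n) ℂ} (hL : HasLogGrad f g L) (U : Matrix (Fin n) (Fin n) ℂ) :
    IsGradient (fun x : G => f x) g U ↔
      U = ((g : GL (Fin n) ℂ) : Matrix (Fin n) (Fin n) ℂ) * average θ L := by
  have hmetric : ∀ Z : Matrix (Fin n) (Fin n) ℂ,
      metric (g : GL (Fin n) ℂ) U (((g : GL (Fin n) ℂ) : Matrix (Fin n) (Fin n) ℂ) * Z) =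
      Matrix.trace
        ((((g : GL (Fin n) ℂ)⁻¹ : GL (Fin n) ℂ) : Matrix (Fin n) (Fin n) ℂ) * U * Z) := fun Z => by
    rw [metric, Units.inv_mul_cancel_left]
  rw [IsGradient, ← Units.inv_mul_eq_iff_eq_mul]
  constructor
  · rintro ⟨hU, hd⟩
    refine h.eq_of_trace_mul hU (h.average_mem L) fun Z hZ => ?_
    rw [h.trace_average_mul L hZ, ← hmetric, hd ⟨Z, hZ⟩, diff_restrict hL]
  · intro hU
    refine ⟨hU ▸ h.average_mem L, fun Z => ?_⟩
    rw [hmetric, hU, h.trace_average_mul L Z.2, diff_restrict hL]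

theorem grad_eq (h : IsFixedBy G θ) {f : GL (Fin n) ℂ → ℂ} {g : G}
    {L : Matrix (Fin n) (Fin n) ℂ} (hL : HasLogGrad f g L) :
    grad (fun x : G => f x) g =
      ((g : GL (Fin n) ℂ) : Matrix (Fin n) (Fin n) ℂ) * average θ L := by
  have hex : ∃ U, IsGradient (fun x : G => f x) g U := ⟨_, (h.isGradient_iff hL _).mpr rfl⟩
  rw [grad, dif_pos hex]
  exact (h.isGradient_iff hL _).mp hex.choose_spec

theorem hasStandardData (h : IsFixedBy G θ) : HasStandardData G where
  triangular _ hX := ⟨_, h.isTriangular_triParts hX, fun _ hp => hp.eq_triParts⟩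
  gradient := by
    rintro _ ⟨f, hf, rfl⟩ g
    obtain ⟨L, hL⟩ := exists_hasLogGrad hf (g : GL (Fin n) ℂ)
    exact ⟨_, (h.isGradient_iff hL _).mpr rfl, fun U hU => (h.isGradient_iff hL U).mp hU⟩

/-- The right-trivialized gradient is $\mathrm{Ad}_g$ of the left one and stays in the Lie algebra
because $g\in G$, so `rMatrix` agrees with `glR` on both. -/
theorem stdBracket_eq (h : IsFixedBy G θ) {f₁ f₂ : GL (Fin n) ℂ → ℂ} {g : G}
    {L₁ L₂ : Matrix (Fin n) (Fin n) ℂ} (h₁ : HasLogGrad f₁ g L₁) (h₂ : HasLogGrad f₂ g L₂) :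
    stdBracket G (fun x : G => f₁ x) (fun x : G => f₂ x) g =
      bivector (g : GL (Fin n) ℂ) (average θ L₁) (average θ L₂) := by
  simp only [stdBracket, h.grad_eq h₁, h.grad_eq h₂, Units.inv_mul_cancel_left]
  rw [h.rMatrix_eq (h.average_mem L₁), ← conjGL_apply, ← conjGL_apply,
    h.rMatrix_eq (conjGL_mem_lieAlg g.2 (h.average_mem L₁))]
  rfl

end IsFixedBy

/-- With $\theta=\mathrm{id}$, the general results also cover $GL_n$. -/
theorem isFixedBy_top : IsFixedBy (⊤ : Subgroup (GL (Fin n) ℂ)) LinearMap.id where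
  mem_lieAlg _ := ⟨fun _ => rfl, fun _ _ => Subgroup.mem_top _⟩
  involutive _ := rfl
  trace_mul _ _ := rfl
  triParts _ := rfl

theorem stdBracketGL_eq {f₁ f₂ : GL (Fin n) ℂ → ℂ} {g : GL (Fin n) ℂ}
    {L₁ L₂ : Matrix (Fin n) (Fin n) ℂ} (h₁ : HasLogGrad f₁ g L₁) (h₂ : HasLogGrad f₂ g L₂) :
    stdBracketGL n f₁ f₂ g = bivector g L₁ L₂ := by
  refine (isFixedBy_top.stdBracket_eq (g := ⟨g, Subgroup.mem_top g⟩) h₁ h₂).trans ?_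
  rw [average_of_fixed rfl, average_of_fixed rfl]

/-! ### Biderivation property on $GL_n$ -/

section Bracket

variable {f f' h : GL (Fin n) ℂ → ℂ}

theorem stdBracketGL_skew (hf : f ∈ regularGL n) (hh : h ∈ regularGL n) :
    stdBracketGL n f h = -stdBracketGL n h f := by
  funext g
  obtain ⟨L, hL⟩ := exists_hasLogGrad hf g
  obtain ⟨M, hM⟩ := exists_hasLogGrad hh g
  rw [Pi.neg_apply, stdBracketGL_eq hL hM, stdBracketGL_eq hM hL, bivector_skew]

theorem stdBracketGL_add_left (hf : f ∈ regularGL n) (hf' : f' ∈ regularGL n)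
    (hh : h ∈ regularGL n) :
    stdBracketGL n (f + f') h = stdBracketGL n f h + stdBracketGL n f' h := by
  funext g
  obtain ⟨L, hL⟩ := exists_hasLogGrad hf g
  obtain ⟨L', hL'⟩ := exists_hasLogGrad hf' g
  obtain ⟨M, hM⟩ := exists_hasLogGrad hh g
  rw [Pi.add_apply, stdBracketGL_eq hL hM, stdBracketGL_eq hL' hM,
    stdBracketGL_eq (hL.add hL') hM, bivector_add_left]

theorem stdBracketGL_mul_left (hf : f ∈ regularGL n) (hf' : f' ∈ regularGL n)
    (hh : h ∈ regularGL n) :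
    stdBracketGL n (f * f') h = f * stdBracketGL n f' h + stdBracketGL n f h * f' := by
  funext g
  obtain ⟨L, hL⟩ := exists_hasLogGrad hf g
  obtain ⟨L', hL'⟩ := exists_hasLogGrad hf' g
  obtain ⟨M, hM⟩ := exists_hasLogGrad hh g
  rw [Pi.add_apply, Pi.mul_apply, Pi.mul_apply, stdBracketGL_eq hL hM, stdBracketGL_eq hL' hM,
    stdBracketGL_eq (hL.mul hL') hM, bivector_add_left, bivector_smul_left, bivector_smul_left,
    mul_comm (f' g)]

theorem stdBracketGL_const_left (c : ℂ) (hh : h ∈ regularGL n) :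
    stdBracketGL n (algebraMap ℂ _ c) h = 0 := by
  funext g
  obtain ⟨M, hM⟩ := exists_hasLogGrad hh g
  rw [stdBracketGL_eq (HasLogGrad.const c) hM, ← zero_smul ℂ (0 : Matrix (Fin n) (Fin n) ℂ),
    bivector_smul_left, zero_mul, Pi.zero_apply]

theorem stdBracketGL_add_right (hf : f ∈ regularGL n) (hf' : f' ∈ regularGL n)
    (hh : h ∈ regularGL n) :
    stdBracketGL n h (f + f') = stdBracketGL n h f + stdBracketGL n h f' := by
  rw [stdBracketGL_skew hh (add_mem hf hf'), stdBracketGL_add_left hf hf' hh,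
    stdBracketGL_skew hh hf, stdBracketGL_skew hh hf', neg_add]

theorem stdBracketGL_mul_right (hf : f ∈ regularGL n) (hf' : f' ∈ regularGL n)
    (hh : h ∈ regularGL n) :
    stdBracketGL n h (f * f') = f * stdBracketGL n h f' + stdBracketGL n h f * f' := by
  rw [stdBracketGL_skew hh (mul_mem hf hf'), stdBracketGL_mul_left hf hf' hh,
    stdBracketGL_skew hh hf, stdBracketGL_skew hh hf']
  ring

theorem stdBracketGL_const_right (c : ℂ) (hh : h ∈ regularGL n) :
    stdBracketGL n h (algebraMap ℂ _ c) = 0 := by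
  rw [stdBracketGL_skew hh ((regularGL n).algebraMap_mem c), stdBracketGL_const_left c hh, neg_zero]

end Bracket

/-- A derivation of `𝒪(GL_n)` whose values on the coordinate functions lie in a submodule `M` has
all its values in `M`. -/
theorem derivation_mem {M : Submodule (regularGL n) (GL (Fin n) ℂ → ℂ)}
    {D : (GL (Fin n) ℂ → ℂ) → (GL (Fin n) ℂ → ℂ)}
    (hconst : ∀ c : ℂ, D (algebraMap ℂ _ c) = 0)
    (hadd : ∀ f ∈ regularGL n, ∀ g ∈ regularGL n, D (f + g) = D f + D g)
    (hmul : ∀ f ∈ regularGL n, ∀ g ∈ regularGL n, D (f * g) = f * D g + D f * g)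
    (hcoord : ∀ i j, D (coord i j) ∈ M) {f : GL (Fin n) ℂ → ℂ} (hf : f ∈ regularGL n) :
    D f ∈ M := by
  have hsmul : ∀ f ∈ regularGL n, ∀ m ∈ M, f * m ∈ M := fun f hf m hm =>
    M.smul_mem (⟨f, hf⟩ : regularGL n) hm
  refine regularGL_induction (p := fun f => D f ∈ M) hcoord ?_ ?_ ?_ ?_ hf
  · intro hd
    -- Applying $D$ to $\det\cdot\det^{-1}=1$ gives $D(\det^{-1})=-\det^{-2}D(\det)$.
    have hunit : detFun n * (detFun n)⁻¹ = 1 := by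
      funext g
      exact mul_inv_cancel₀ (detFun_ne_zero g)
    have h1 : detFun n * D (detFun n)⁻¹ + D (detFun n) * (detFun n)⁻¹ = 0 := by
      rw [← hmul _ detFun_mem _ inv_detFun_mem, hunit]
      simpa using hconst 1
    have h2 : D (detFun n)⁻¹ = (-((detFun n)⁻¹ * (detFun n)⁻¹)) * D (detFun n) := by
      linear_combination (detFun n)⁻¹ * h1 - D (detFun n)⁻¹ * hunit
    rw [h2]
    exact hsmul _ (neg_mem (mul_mem inv_detFun_mem inv_detFun_mem)) _ hd
  · intro c
    rw [hconst]
    exact M.zero_mem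
  · intro f hf g hg hDf hDg
    rw [hadd f hf g hg]
    exact M.add_mem hDf hDg
  · intro f hf g hg hDf hDg
    rw [hmul f hf g hg, mul_comm (D f)]
    exact M.add_mem (hsmul f hf _ hDg) (hsmul g hg _ hDf)

/-! ### Brackets of coordinates and the Jacobi identity -/

/-- The sign of `j - i`. -/
def ordSign (i j : Fin n) : ℂ := if i < j then 1 else if j < i then -1 else 0

theorem ordSign_skew (i j : Fin n) : ordSign i j = -ordSign j i := by
  rcases lt_trichotomy i j with h | h | h
  · simp [ordSign, h, h.not_gt]
  · simp [ordSign, h]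
  · simp [ordSign, h, h.not_gt]

theorem glR_apply (X : Matrix (Fin n) (Fin n) ℂ) (i j : Fin n) :
    glR X i j = ordSign i j * X i j := rfl

/-- The gradient of $x_{ij}$ is $E_{ji}g$ in the left trivialization and $gE_{ji}$ in the right one;
each trace collapses to a single product of entries, with a column sign from the left and a row sign
from the right. -/
theorem stdBracketGL_coord (i j k l : Fin n) :
    stdBracketGL n (coord i j) (coord k l) =
      ((1 / 2 : ℂ) * (ordSign i k + ordSign j l)) • (coord i l * coord k j) := by
  funext g
  rw [stdBracketGL_eq (HasLogGrad.coord i j) (HasLogGrad.coord k l), bivector]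
  have hc : ∀ a b : Fin n, conjGL g (Matrix.single b a 1 * (g : Matrix (Fin n) (Fin n) ℂ)) =
      (g : Matrix (Fin n) (Fin n) ℂ) * Matrix.single b a 1 := fun a b => by
    rw [conjGL_apply, mul_assoc, mul_assoc, Units.mul_inv, mul_one]
  have h1 : Matrix.trace (glR (Matrix.single j i 1 * (g : Matrix (Fin n) (Fin n) ℂ)) *
      (Matrix.single l k 1 * (g : Matrix (Fin n) (Fin n) ℂ))) =
      ordSign j l * (coord i l g * coord k j g) := by
    rw [← mul_assoc, Matrix.trace_mul_comm, ← mul_assoc, Matrix.trace_mul_single]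
    simp [Matrix.mul_apply, glR_apply, Matrix.single_apply, ite_and, coord]
    ring
  have h2 : Matrix.trace (glR ((g : Matrix (Fin n) (Fin n) ℂ) * Matrix.single j i 1) *
      ((g : Matrix (Fin n) (Fin n) ℂ) * Matrix.single l k 1)) =
      ordSign k i * (coord i l g * coord k j g) := by
    rw [← mul_assoc, Matrix.trace_mul_single]
    simp [Matrix.mul_apply, glR_apply, Matrix.single_apply, ite_and, coord]
    ring
  rw [hc, hc, h1, h2, ordSign_skew k i]
  simp only [Pi.smul_apply, Pi.mul_apply, smul_eq_mul]
  ring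

theorem stdBracketGL_mem {f h : GL (Fin n) ℂ → ℂ} (hf : f ∈ regularGL n) (hh : h ∈ regularGL n) :
    stdBracketGL n f h ∈ regularGL n := by
  -- The coordinate ring as a module over itself; `derivation_mem` is then applied in each argument.
  let M : Submodule (regularGL n) (GL (Fin n) ℂ → ℂ) :=
    { carrier := regularGL n
      add_mem' := add_mem
      zero_mem' := zero_mem _
      smul_mem' := fun a _ hx => mul_mem a.2 hx }
  have hcoord : ∀ i j, ∀ h ∈ regularGL n, stdBracketGL n h (coord i j) ∈ M := fun i j h hh =>
    derivation_mem (M := M) (D := fun f => stdBracketGL n f (coord i j))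
      (fun c => stdBracketGL_const_left c (coord_mem i j))
      (fun f hf g hg => stdBracketGL_add_left hf hg (coord_mem i j))
      (fun f hf g hg => stdBracketGL_mul_left hf hg (coord_mem i j))
      (fun k l => by
        change _ ∈ regularGL n
        rw [stdBracketGL_coord]
        exact (regularGL n).smul_mem (mul_mem (coord_mem _ _) (coord_mem _ _)) _) hh
  exact derivation_mem (M := M) (D := fun h => stdBracketGL n f h)
      (fun c => stdBracketGL_const_right c hf)
      (fun h hh g hg => stdBracketGL_add_right hh hg hf)
      (fun h hh g hg => stdBracketGL_mul_right hh hg hf)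
      (fun k l => hcoord k l f hf) hh

/-- The Jacobiator of the standard bracket of `GL_n`. -/
def jacobiator (f g h : GL (Fin n) ℂ → ℂ) : GL (Fin n) ℂ → ℂ :=
  stdBracketGL n f (stdBracketGL n g h) + stdBracketGL n g (stdBracketGL n h f) +
    stdBracketGL n h (stdBracketGL n f g)

theorem jacobiator_rotate (f g h : GL (Fin n) ℂ → ℂ) : jacobiator f g h = jacobiator g h f := by
  simp only [jacobiator]
  ring

/-- The Jacobiator vanishes if it vanishes when the first argument is a coordinate function. -/
theorem jacobiator_eq_zero_of_coord {g h : GL (Fin n) ℂ → ℂ} (hg : g ∈ regularGL n)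
    (hh : h ∈ regularGL n) (hcoord : ∀ i j, jacobiator (coord i j) g h = 0)
    {f : GL (Fin n) ℂ → ℂ} (hf : f ∈ regularGL n) : jacobiator f g h = 0 := by
  have hgh := stdBracketGL_mem hg hh
  refine derivation_mem (M := ⊥) (D := fun f => jacobiator f g h) ?_ ?_ ?_ hcoord hf
  · intro c
    have h0 : ∀ f ∈ regularGL n, stdBracketGL n f 0 = 0 := fun f hf => by
      simpa using stdBracketGL_const_right (n := n) 0 hf
    simp only [jacobiator]
    rw [stdBracketGL_const_left c hgh, stdBracketGL_const_left c hg,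
      stdBracketGL_const_right c hh, h0 g hg, h0 h hh, add_zero, add_zero]
  · intro f hf f' hf'
    simp only [jacobiator]
    rw [stdBracketGL_add_left hf hf' hgh, stdBracketGL_add_right hf hf' hh,
      stdBracketGL_add_left hf hf' hg,
      stdBracketGL_add_right (stdBracketGL_mem hh hf) (stdBracketGL_mem hh hf') hg,
      stdBracketGL_add_right (stdBracketGL_mem hf hg) (stdBracketGL_mem hf' hg) hh]
    ring
  -- The Jacobiator is a derivation because the cross terms, products of a bracket with $f$ and a
  -- bracket with $f'$, cancel by skew-symmetry.
  · intro f hf f' hf'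
    have hhf := stdBracketGL_mem hh hf
    have hhf' := stdBracketGL_mem hh hf'
    have hfg := stdBracketGL_mem hf hg
    have hfg' := stdBracketGL_mem hf' hg
    simp only [jacobiator]
    rw [stdBracketGL_mul_left hf hf' hgh, stdBracketGL_mul_right hf hf' hh,
      stdBracketGL_mul_left hf hf' hg,
      stdBracketGL_add_right (mul_mem hf hhf') (mul_mem hhf hf') hg,
      stdBracketGL_add_right (mul_mem hf hfg') (mul_mem hfg hf') hh,
      stdBracketGL_mul_right hf hhf' hg, stdBracketGL_mul_right hhf hf' hg,
      stdBracketGL_mul_right hf hfg' hh, stdBracketGL_mul_right hfg hf' hh,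
      stdBracketGL_skew hg hf, stdBracketGL_skew hg hf']
    ring

/-- Around a cycle of three indices, not all equal, the signs are $\pm(1,1,-1)$ or a permutation of
$(1,-1,0)$. This is the modified Yang–Baxter equation for $r$ in matrix entries. -/
theorem ordSign_cyclic (a i k : Fin n) :
    ordSign a i * ordSign i k + ordSign i k * ordSign k a + ordSign k a * ordSign a i =
      if a = i ∧ i = k then 0 else -1 := by
  simp only [ordSign, Fin.lt_def, Fin.ext_iff]
  split_ifs <;> first | omega | norm_num

theorem jacobiator_coord (a b i j k l : Fin n) :
    jacobiator (coord a b) (coord i j) (coord k l) = 0 := by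
  have hs : ∀ (c : ℂ) (f g h : GL (Fin n) ℂ → ℂ), f ∈ regularGL n → g ∈ regularGL n →
      h ∈ regularGL n → stdBracketGL n f (c • (g * h)) =
        c • (g * stdBracketGL n f h + stdBracketGL n f g * h) := fun c f g h hf hg hh => by
    rw [Algebra.smul_def, stdBracketGL_mul_right ((regularGL n).algebraMap_mem c) (mul_mem hg hh) hf,
      stdBracketGL_const_right c hf, zero_mul, add_zero, stdBracketGL_mul_right hg hh hf,
      ← Algebra.smul_def]
  simp only [jacobiator, stdBracketGL_coord, hs _ _ _ _ (coord_mem _ _) (coord_mem _ _)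
    (coord_mem _ _)]
  funext g
  simp only [Pi.add_apply, Pi.smul_apply, Pi.mul_apply, smul_eq_mul, Pi.zero_apply]
  have hr := ordSign_cyclic a i k
  have hc := ordSign_cyclic b j l
  rw [ordSign_skew k i, ordSign_skew i a, ordSign_skew a k, ordSign_skew l j, ordSign_skew j b,
    ordSign_skew b l]
  -- The Jacobiator is $\tfrac14$ of the row cyclic sum minus the column cyclic sum, times a
  -- difference of two cubic monomials, up to sign. The cyclic sums differ only if exactly one index
  -- triple is constant, and then the monomials coincide.
  have hm : ((if a = i ∧ i = k then (0 : ℂ) else -1) - (if b = j ∧ j = l then (0 : ℂ) else -1)) *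
      (coord a l g * coord i b g * coord k j g - coord i l g * coord a j g * coord k b g) = 0 := by
    by_cases h1 : a = i ∧ i = k
    · obtain ⟨rfl, rfl⟩ := h1
      ring
    · by_cases h2 : b = j ∧ j = l
      · obtain ⟨rfl, rfl⟩ := h2
        ring
      · simp [h1, h2]
  rw [← hr, ← hc] at hm
  linear_combination (1 / 4 : ℂ) * hm

theorem jacobiator_eq_zero {f g h : GL (Fin n) ℂ → ℂ} (hf : f ∈ regularGL n)
    (hg : g ∈ regularGL n) (hh : h ∈ regularGL n) : jacobiator f g h = 0 := by
  refine jacobiator_eq_zero_of_coord hg hh (fun a b => ?_) hf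
  rw [jacobiator_rotate]
  refine jacobiator_eq_zero_of_coord hh (coord_mem a b) (fun i j => ?_) hg
  rw [jacobiator_rotate]
  refine jacobiator_eq_zero_of_coord (coord_mem a b) (coord_mem i j) (fun k l => ?_) hh
  rw [jacobiator_rotate]
  exact jacobiator_coord a b i j k l

theorem isPoissonBracket_GL : IsPoissonBracket (regularGL n) (stdBracketGL n) where
  mem _ hf _ hg := stdBracketGL_mem hf hg
  add_left _ hf _ hg _ hh := stdBracketGL_add_left hf hg hh
  smul_left c f hf g hg := by
    rw [Algebra.smul_def, stdBracketGL_mul_left ((regularGL n).algebraMap_mem c) hf hg,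
      stdBracketGL_const_left c hg, zero_mul, add_zero, ← Algebra.smul_def]
  skew _ hf _ hg := stdBracketGL_skew hf hg
  leibniz _ hf _ hg _ hh := stdBracketGL_mul_left hf hg hh
  jacobi _ hf _ hg _ hh := jacobiator_eq_zero hf hg hh

/-! ### The involution $\tau$ and its differential $\theta$ -/

theorem transposeGL_inv (A : GL (Fin n) ℂ) : transposeGL A⁻¹ = (transposeGL A)⁻¹ := by
  rw [eq_inv_iff_mul_eq_one, ← transposeGL_mul, mul_inv_cancel, transposeGL_one]

@[simp]
theorem coe_transposeGL (A : GL (Fin n) ℂ) :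
    ((transposeGL A : GL (Fin n) ℂ) : Matrix (Fin n) (Fin n) ℂ) =
      (A : Matrix (Fin n) (Fin n) ℂ)ᵀ := rfl

theorem tau_mul (Ω A B : GL (Fin n) ℂ) : tau Ω (A * B) = tau Ω A * tau Ω B := by
  simp only [tau, mul_inv_rev, transposeGL_mul]
  group

theorem mem_formGroup_iff (Ω A : GL (Fin n) ℂ) : A ∈ formGroup Ω ↔ tau Ω A = A := by
  change A * Ω * transposeGL A = Ω ↔ _
  rw [tau, transposeGL_inv, mul_inv_eq_iff_eq_mul, mul_inv_eq_iff_eq_mul, eq_comm]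

/-- The differential of `τ` at the identity. -/
def theta (Ω : GL (Fin n) ℂ) : Matrix (Fin n) (Fin n) ℂ →ₗ[ℂ] Matrix (Fin n) (Fin n) ℂ :=
  -(conjGL Ω ∘ₗ (Matrix.transposeLinearEquiv (Fin n) (Fin n) ℂ ℂ).toLinearMap)

theorem theta_apply (Ω : GL (Fin n) ℂ) (X : Matrix (Fin n) (Fin n) ℂ) :
    theta Ω X = -conjGL Ω Xᵀ := rfl

theorem conjGL_mul (g : GL (Fin n) ℂ) (X Y : Matrix (Fin n) (Fin n) ℂ) :
    conjGL g (X * Y) = conjGL g X * conjGL g Y := by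
  simp only [conjGL_apply, mul_assoc, Units.inv_mul_cancel_left]

theorem conjGL_conjGL (g h : GL (Fin n) ℂ) (X : Matrix (Fin n) (Fin n) ℂ) :
    conjGL g (conjGL h X) = conjGL (g * h) X := by
  simp only [conjGL_apply, mul_inv_rev, Units.val_mul, mul_assoc]

theorem transpose_conjGL (g : GL (Fin n) ℂ) (X : Matrix (Fin n) (Fin n) ℂ) :
    (conjGL g X)ᵀ = conjGL (transposeGL g⁻¹) Xᵀ := by
  rw [conjGL_apply, conjGL_apply, Matrix.transpose_mul, Matrix.transpose_mul, ← mul_assoc,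
    ← transposeGL_inv, inv_inv]
  rfl

theorem trace_conjGL (g : GL (Fin n) ℂ) (X : Matrix (Fin n) (Fin n) ℂ) :
    Matrix.trace (conjGL g X) = Matrix.trace X := by
  rw [conjGL_apply, Matrix.trace_mul_comm, ← mul_assoc, Units.inv_mul, one_mul]

theorem trace_theta_mul (Ω : GL (Fin n) ℂ) (X Y : Matrix (Fin n) (Fin n) ℂ) :
    Matrix.trace (theta Ω X * theta Ω Y) = Matrix.trace (X * Y) := by
  rw [theta_apply, theta_apply, neg_mul_neg, ← conjGL_mul, trace_conjGL, ← Matrix.transpose_mul,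
    Matrix.trace_transpose, Matrix.trace_mul_comm]

theorem theta_conjGL (Ω g : GL (Fin n) ℂ) (X : Matrix (Fin n) (Fin n) ℂ) :
    theta Ω (conjGL g X) = conjGL (tau Ω g) (theta Ω X) := by
  rw [theta_apply, theta_apply, transpose_conjGL, map_neg, conjGL_conjGL, conjGL_conjGL, tau,
    inv_mul_cancel_right]

theorem tau_expGL (Ω : GL (Fin n) ℂ) (X : Matrix (Fin n) (Fin n) ℂ) :
    tau Ω (expGL X) = expGL (theta Ω X) := by
  rw [theta_apply, expGL_neg, conjGL_apply, expGL_conj, expGL_transpose, tau, transposeGL_inv]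
  group

section Symmetric

variable {Ω : GL (Fin n) ℂ}

theorem transposeGL_eq_or
    (hsym : (Ω : Matrix (Fin n) (Fin n) ℂ)ᵀ = (Ω : Matrix (Fin n) (Fin n) ℂ) ∨
        (Ω : Matrix (Fin n) (Fin n) ℂ)ᵀ = -(Ω : Matrix (Fin n) (Fin n) ℂ)) :
    transposeGL Ω = Ω ∨ transposeGL Ω = -Ω :=
  hsym.imp (fun h => Units.ext h) (fun h => Units.ext h)

/-- $\tau^2$ is conjugation by $\Omega\Omega^{-t}$, which is $\pm1$ and hence central. -/
theorem tau_tau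
    (hsym : (Ω : Matrix (Fin n) (Fin n) ℂ)ᵀ = (Ω : Matrix (Fin n) (Fin n) ℂ) ∨
        (Ω : Matrix (Fin n) (Fin n) ℂ)ᵀ = -(Ω : Matrix (Fin n) (Fin n) ℂ))
    (A : GL (Fin n) ℂ) : tau Ω (tau Ω A) = A := by
  have h : tau Ω (tau Ω A) = Ω * (transposeGL Ω)⁻¹ * A * (Ω * (transposeGL Ω)⁻¹)⁻¹ := by
    have ht : transposeGL (transposeGL A) = A := Units.ext (Matrix.transpose_transpose _)
    simp only [tau, transposeGL_mul, transposeGL_inv, mul_inv_rev, inv_inv, ht]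
    group
  rw [h]
  rcases transposeGL_eq_or hsym with h | h <;> rw [h] <;> simp

theorem theta_theta
    (hsym : (Ω : Matrix (Fin n) (Fin n) ℂ)ᵀ = (Ω : Matrix (Fin n) (Fin n) ℂ) ∨
        (Ω : Matrix (Fin n) (Fin n) ℂ)ᵀ = -(Ω : Matrix (Fin n) (Fin n) ℂ))
    (X : Matrix (Fin n) (Fin n) ℂ) : theta Ω (theta Ω X) = X := by
  rw [theta_apply, theta_apply, Matrix.transpose_neg, map_neg, neg_neg, transpose_conjGL,
    Matrix.transpose_transpose, conjGL_conjGL, transposeGL_inv]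
  rcases transposeGL_eq_or hsym with h | h <;> rw [h] <;> simp [conjGL_apply]

end Symmetric

/-- Since $\tau(e^{tX})=e^{t\theta X}$, membership means $e^{t\theta X}=e^{tX}$ for all $t$;
differentiating at $0$ gives $\theta X=X$. -/
theorem mem_lieAlg_formGroup (Ω : GL (Fin n) ℂ) (X : Matrix (Fin n) (Fin n) ℂ) :
    X ∈ lieAlg (formGroup Ω) ↔ theta Ω X = X := by
  constructor
  · intro h
    ext i j
    have h1 := hasDerivAt_exp_smul_apply X i j
    have h2 := hasDerivAt_exp_smul_apply (theta Ω X) i j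
    refine h2.unique (h1.congr_of_eventuallyEq (Filter.Eventually.of_forall fun t => ?_))
    have := (mem_formGroup_iff Ω _).mp (h t)
    rw [tau_expGL, map_smul] at this
    exact congrArg (fun A : GL (Fin n) ℂ => (A : Matrix (Fin n) (Fin n) ℂ) i j) this
  · intro h t
    rw [mem_formGroup_iff, tau_expGL, map_smul, h]

/-! ### Anti-diagonal $\Omega$: compatibility with the triangular decomposition -/

section AntiDiagonal

variable {Ω : GL (Fin n) ℂ}

/-- Each entry of $\Omega\Omega^{-1}=1$ is a single product, whose factor from $\Omega$ is nonzero
by the diagonal entries. -/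
theorem inv_antidiagonal
    (hanti : ∀ i j : Fin n, j ≠ i.rev → (Ω : Matrix (Fin n) (Fin n) ℂ) i j = 0)
    (i j : Fin n) (hij : j ≠ i.rev) :
    ((Ω⁻¹ : GL (Fin n) ℂ) : Matrix (Fin n) (Fin n) ℂ) i j = 0 := by
  have key : ∀ k l : Fin n, (Ω : Matrix (Fin n) (Fin n) ℂ) k k.rev *
      ((Ω⁻¹ : GL (Fin n) ℂ) : Matrix (Fin n) (Fin n) ℂ) k.rev l =
        (1 : Matrix (Fin n) (Fin n) ℂ) k l := fun k l => by
    rw [← Units.mul_inv Ω, Matrix.mul_apply, Finset.sum_eq_single k.rev]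
    · exact fun m _ hm => by rw [hanti k m hm, zero_mul]
    · exact fun h => absurd (Finset.mem_univ _) h
  have hne : (Ω : Matrix (Fin n) (Fin n) ℂ) i.rev i.rev.rev ≠ 0 := fun h0 => by
    have := key i.rev i.rev
    rw [h0, zero_mul, Matrix.one_apply_eq] at this
    exact zero_ne_one this
  have := key i.rev j
  rw [Matrix.one_apply_ne hij.symm, mul_eq_zero] at this
  simpa using this.resolve_left hne

theorem theta_entry
    (hanti : ∀ i j : Fin n, j ≠ i.rev → (Ω : Matrix (Fin n) (Fin n) ℂ) i j = 0)
    (X : Matrix (Fin n) (Fin n) ℂ) (i j : Fin n) :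
    theta Ω X i j = -((Ω : Matrix (Fin n) (Fin n) ℂ) i i.rev * X j.rev i.rev *
      ((Ω⁻¹ : GL (Fin n) ℂ) : Matrix (Fin n) (Fin n) ℂ) j.rev j) := by
  rw [theta_apply, conjGL_apply, Matrix.neg_apply, Matrix.mul_apply,
    Finset.sum_eq_single j.rev, Matrix.mul_apply, Finset.sum_eq_single i.rev]
  · rfl
  · exact fun m _ hm => by rw [hanti i m hm, zero_mul]
  · exact fun h => absurd (Finset.mem_univ _) h
  · intro m _ hm
    rw [inv_antidiagonal hanti m j (fun h => hm (by rw [h, Fin.rev_rev])), mul_zero]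
  · exact fun h => absurd (Finset.mem_univ _) h

/-- $\theta$ moves the entry at $(\mathrm{rev}\,j,\mathrm{rev}\,i)$ to $(i,j)$ up to a scalar; this
reflection in the anti-diagonal preserves the order relation of row and column. -/
theorem triParts_theta
    (hanti : ∀ i j : Fin n, j ≠ i.rev → (Ω : Matrix (Fin n) (Fin n) ℂ) i j = 0)
    (X : Matrix (Fin n) (Fin n) ℂ) :
    triParts (theta Ω X) = Prod.map (theta Ω) (Prod.map (theta Ω) (theta Ω)) (triParts X) := by
  refine Prod.ext ?_ (Prod.ext ?_ ?_) <;> ext i j <;>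
    simp only [Prod.map_fst, Prod.map_snd, theta_entry hanti] <;>
    simp only [triParts, Matrix.of_apply, theta_entry hanti, Fin.rev_lt_rev, Fin.rev_inj,
      @eq_comm _ j i] <;> split_ifs <;> simp

theorem glR_theta
    (hanti : ∀ i j : Fin n, j ≠ i.rev → (Ω : Matrix (Fin n) (Fin n) ℂ) i j = 0)
    (X : Matrix (Fin n) (Fin n) ℂ) : glR (theta Ω X) = theta Ω (glR X) := by
  rw [← triParts_sub, ← triParts_sub, triParts_theta hanti, map_sub]
  rfl

end AntiDiagonal

/-! ### Action of $\tau$ on gradients and on the bivector -/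

section Involution

variable {Ω : GL (Fin n) ℂ}

/-- $\tau(ge^{tX})=\tau(g)e^{t\theta X}$, and $\theta$, an isometric involution, is self-adjoint:
$\mathrm{Tr}(L\,\theta X)=\mathrm{Tr}(\theta L\,X)$. -/
theorem HasLogGrad.comp_tau
    (hsym : (Ω : Matrix (Fin n) (Fin n) ℂ)ᵀ = (Ω : Matrix (Fin n) (Fin n) ℂ) ∨
        (Ω : Matrix (Fin n) (Fin n) ℂ)ᵀ = -(Ω : Matrix (Fin n) (Fin n) ℂ))
    {f : GL (Fin n) ℂ → ℂ} {g : GL (Fin n) ℂ}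
    {L : Matrix (Fin n) (Fin n) ℂ} (h : HasLogGrad f (tau Ω g) L) :
    HasLogGrad (f ∘ tau Ω) g (theta Ω L) := fun X => by
  have hX := h (theta Ω X)
  rw [← trace_theta_mul Ω, theta_theta hsym] at hX
  simpa only [Function.comp_def, tau_mul, tau_expGL, map_smul] using hX


theorem bivector_theta
    (hanti : ∀ i j : Fin n, j ≠ i.rev → (Ω : Matrix (Fin n) (Fin n) ℂ) i j = 0)
    (hsym : (Ω : Matrix (Fin n) (Fin n) ℂ)ᵀ = (Ω : Matrix (Fin n) (Fin n) ℂ) ∨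
        (Ω : Matrix (Fin n) (Fin n) ℂ)ᵀ = -(Ω : Matrix (Fin n) (Fin n) ℂ))
    (g : GL (Fin n) ℂ) (X Y : Matrix (Fin n) (Fin n) ℂ) :
    bivector g (theta Ω X) (theta Ω Y) = bivector (tau Ω g) X Y := by
  have hc : ∀ Z, conjGL g (theta Ω Z) = theta Ω (conjGL (tau Ω g) Z) := fun Z => by
    rw [theta_conjGL, tau_tau hsym]
  rw [bivector, bivector, hc, hc, glR_theta hanti, glR_theta hanti, trace_theta_mul,
    trace_theta_mul]

theorem isFixedBy_formGroup
    (hanti : ∀ i j : Fin n, j ≠ i.rev → (Ω : Matrix (Fin n) (Fin n) ℂ) i j = 0)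
    (hsym : (Ω : Matrix (Fin n) (Fin n) ℂ)ᵀ = (Ω : Matrix (Fin n) (Fin n) ℂ) ∨
        (Ω : Matrix (Fin n) (Fin n) ℂ)ᵀ = -(Ω : Matrix (Fin n) (Fin n) ℂ)) :
    IsFixedBy (formGroup Ω) (theta Ω) where
  mem_lieAlg := mem_lieAlg_formGroup Ω
  involutive := theta_theta hsym
  trace_mul := trace_theta_mul Ω
  triParts := triParts_theta hanti

end Involution

/-! ### Regularity of $\tau$ -/

theorem inv_entry_mem (i j : Fin n) :
    (fun A : GL (Fin n) ℂ => ((A⁻¹ : GL (Fin n) ℂ) : Matrix (Fin n) (Fin n) ℂ) i j) ∈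
      regularGL n := by
  have h : (fun A : GL (Fin n) ℂ => ((A⁻¹ : GL (Fin n) ℂ) : Matrix (Fin n) (Fin n) ℂ) i j) =
      (detFun n)⁻¹ * fun A : GL (Fin n) ℂ =>
        ((A : Matrix (Fin n) (Fin n) ℂ).updateRow j (Pi.single i 1)).det := by
    funext A
    rw [Matrix.coe_units_inv, Matrix.inv_def, Matrix.smul_apply, Matrix.adjugate_apply,
      Ring.inverse_eq_inv, smul_eq_mul]
    rfl
  rw [h]
  refine mul_mem inv_detFun_mem (det_mem_subalgebra _ _ fun k l => ?_)
  by_cases hk : k = j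
  · subst hk
    simp only [Matrix.updateRow_self]
    exact (regularGL n).algebraMap_mem ((Pi.single i 1 : Fin n → ℂ) l)
  · simp only [Matrix.updateRow_ne hk]
    exact coord_mem k l

theorem comp_tau_mem (Ω : GL (Fin n) ℂ) {f : GL (Fin n) ℂ → ℂ} (hf : f ∈ regularGL n) :
    f ∘ tau Ω ∈ regularGL n := by
  have hcoord : ∀ i j, coord i j ∘ tau Ω ∈ regularGL n := fun i j => by
    have h : coord i j ∘ tau Ω = ∑ k, ∑ l,
        ((Ω : Matrix (Fin n) (Fin n) ℂ) i l * ((Ω⁻¹ : GL (Fin n) ℂ) : Matrix (Fin n) (Fin n) ℂ) k j) •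
          fun A : GL (Fin n) ℂ => ((A⁻¹ : GL (Fin n) ℂ) : Matrix (Fin n) (Fin n) ℂ) k l := by
      funext A
      simp only [Function.comp_apply, coord, tau, Units.val_mul, coe_transposeGL, Matrix.mul_apply,
        Finset.sum_apply, Finset.sum_mul, Pi.smul_apply, smul_eq_mul, Matrix.transpose_apply]
      exact Finset.sum_congr rfl fun k _ => Finset.sum_congr rfl fun l _ => by ring
    rw [h]
    exact sum_mem fun k _ => sum_mem fun l _ => (regularGL n).smul_mem (inv_entry_mem k l) _
  refine regularGL_induction (p := fun f => f ∘ tau Ω ∈ regularGL n) hcoord ?_ ?_ ?_ ?_ hf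
  · intro _
    -- $\det\tau(A)=1/\det A$, so $\tau$ carries the generator $1/\det$ to $\det$.
    have h : (detFun n)⁻¹ ∘ tau Ω = detFun n := by
      funext A
      have hΩ := detFun_ne_zero Ω
      have hA := detFun_ne_zero A
      simp only [Function.comp_apply, Pi.inv_apply, detFun, tau, Units.val_mul, coe_transposeGL,
        Matrix.det_mul, Matrix.det_transpose, Matrix.coe_units_inv, Matrix.det_nonsing_inv,
        Ring.inverse_eq_inv] at hΩ hA ⊢
      field_simp
    rw [h]
    exact detFun_mem
  · exact fun c => (regularGL n).algebraMap_mem c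
  · exact fun _ _ _ _ h h' => add_mem h h'
  · exact fun _ _ _ _ h h' => mul_mem h h'

/-! ### The induced bracket on $G(\Omega)$ -/

/-- A bracket induced by a Poisson bracket on the fixed points of an involution is a Poisson
bracket. -/
theorem IsInducedBracket.isPoissonBracket {X : Type*} {A : Subalgebra ℂ (X → ℂ)}
    {br : (X → ℂ) → (X → ℂ) → (X → ℂ)} {τ : X → X} {Y : Set X}
    {brY : (Y → ℂ) → (Y → ℂ) → (Y → ℂ)} (h : IsInducedBracket A br τ Y brY)
    (hbr : IsPoissonBracket A br) : IsPoissonBracket (A.map (restrict Y)) brY := by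
  have hadd : ∀ f ∈ invariants A τ, ∀ g ∈ invariants A τ, f + g ∈ invariants A τ :=
    fun f hf g hg => ⟨add_mem hf.1 hg.1, congrArg₂ (· + ·) hf.2 hg.2⟩
  have hmul : ∀ f ∈ invariants A τ, ∀ g ∈ invariants A τ, f * g ∈ invariants A τ :=
    fun f hf g hg => ⟨mul_mem hf.1 hg.1, congrArg₂ (· * ·) hf.2 hg.2⟩
  have hsmul : ∀ c : ℂ, ∀ f ∈ invariants A τ, c • f ∈ invariants A τ :=
    fun c f hf => ⟨A.smul_mem hf.1 c, congrArg (c • ·) hf.2⟩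
  refine ⟨?_, ?_, ?_, ?_, ?_, ?_⟩
  · intro φ hφ ψ hψ
    obtain ⟨f, hf, rfl⟩ := h.surj φ hφ
    obtain ⟨g, hg, rfl⟩ := h.surj ψ hψ
    rw [h.bracket_eq f hf g hg]
    exact ⟨_, hbr.mem f hf.1 g hg.1, rfl⟩
  · intro φ hφ ψ hψ χ hχ
    obtain ⟨f, hf, rfl⟩ := h.surj φ hφ
    obtain ⟨g, hg, rfl⟩ := h.surj ψ hψ
    obtain ⟨k, hk, rfl⟩ := h.surj χ hχ
    rw [← map_add, h.bracket_eq _ (hadd f hf g hg) k hk, h.bracket_eq f hf k hk,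
      h.bracket_eq g hg k hk, hbr.add_left f hf.1 g hg.1 k hk.1, map_add]
  · intro c φ hφ ψ hψ
    obtain ⟨f, hf, rfl⟩ := h.surj φ hφ
    obtain ⟨g, hg, rfl⟩ := h.surj ψ hψ
    rw [← map_smul, h.bracket_eq _ (hsmul c f hf) g hg, h.bracket_eq f hf g hg,
      hbr.smul_left c f hf.1 g hg.1, map_smul]
  · intro φ hφ ψ hψ
    obtain ⟨f, hf, rfl⟩ := h.surj φ hφ
    obtain ⟨g, hg, rfl⟩ := h.surj ψ hψ
    rw [h.bracket_eq f hf g hg, h.bracket_eq g hg f hf, hbr.skew f hf.1 g hg.1, map_neg]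
  · intro φ hφ ψ hψ χ hχ
    obtain ⟨f, hf, rfl⟩ := h.surj φ hφ
    obtain ⟨g, hg, rfl⟩ := h.surj ψ hψ
    obtain ⟨k, hk, rfl⟩ := h.surj χ hχ
    rw [← map_mul, h.bracket_eq _ (hmul f hf g hg) k hk, h.bracket_eq f hf k hk,
      h.bracket_eq g hg k hk, hbr.leibniz f hf.1 g hg.1 k hk.1, map_add, map_mul, map_mul]
  · intro φ hφ ψ hψ χ hχ
    obtain ⟨f, hf, rfl⟩ := h.surj φ hφ
    obtain ⟨g, hg, rfl⟩ := h.surj ψ hψ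
    obtain ⟨k, hk, rfl⟩ := h.surj χ hχ
    rw [h.bracket_eq g hg k hk, h.bracket_eq k hk f hf, h.bracket_eq f hf g hg,
      h.bracket_eq f hf _ (h.closed g hg k hk), h.bracket_eq g hg _ (h.closed k hk f hf),
      h.bracket_eq k hk _ (h.closed f hf g hg), ← map_add, ← map_add,
      hbr.jacobi f hf.1 g hg.1 k hk.1, map_zero]

section Main

variable {Ω : GL (Fin n) ℂ}

theorem isPoissonInvolution_tau
    (hanti : ∀ i j : Fin n, j ≠ i.rev → (Ω : Matrix (Fin n) (Fin n) ℂ) i j = 0)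
    (hsym : (Ω : Matrix (Fin n) (Fin n) ℂ)ᵀ = (Ω : Matrix (Fin n) (Fin n) ℂ) ∨
        (Ω : Matrix (Fin n) (Fin n) ℂ)ᵀ = -(Ω : Matrix (Fin n) (Fin n) ℂ)) :
    IsPoissonInvolution (regularGL n) (stdBracketGL n) (tau Ω) where
  involutive := tau_tau hsym
  regular _ hf := comp_tau_mem Ω hf
  map_bracket f hf h hh := by
    funext g
    obtain ⟨L, hL⟩ := exists_hasLogGrad hf (tau Ω g)
    obtain ⟨M, hM⟩ := exists_hasLogGrad hh (tau Ω g)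
    rw [stdBracketGL_eq (hL.comp_tau hsym) (hM.comp_tau hsym), Function.comp_apply,
      stdBracketGL_eq hL hM, bivector_theta hanti hsym]

theorem stdBracket_formGroup_restrict
    (hanti : ∀ i j : Fin n, j ≠ i.rev → (Ω : Matrix (Fin n) (Fin n) ℂ) i j = 0)
    (hsym : (Ω : Matrix (Fin n) (Fin n) ℂ)ᵀ = (Ω : Matrix (Fin n) (Fin n) ℂ) ∨
        (Ω : Matrix (Fin n) (Fin n) ℂ)ᵀ = -(Ω : Matrix (Fin n) (Fin n) ℂ))
    {f h : GL (Fin n) ℂ → ℂ}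
    (hf : f ∈ invariants (regularGL n) (tau Ω)) (hh : h ∈ invariants (regularGL n) (tau Ω)) :
    stdBracket (formGroup Ω) (restrict (formGroup Ω : Set (GL (Fin n) ℂ)) f)
      (restrict (formGroup Ω : Set (GL (Fin n) ℂ)) h) =
      restrict (formGroup Ω : Set (GL (Fin n) ℂ)) (stdBracketGL n f h) := by
  funext g
  have hg : tau Ω (g : GL (Fin n) ℂ) = g := (mem_formGroup_iff Ω _).mp g.2
  -- At a fixed point both $L$ and $\theta L$ are gradients of the same invariant function, so they
  -- coincide.
  have hfix : ∀ {f : GL (Fin n) ℂ → ℂ} {L : Matrix (Fin n) (Fin n) ℂ}, f ∘ tau Ω = f →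
      HasLogGrad f g L → theta Ω L = L := fun {f L} hf hL => by
    have := HasLogGrad.comp_tau (g := (g : GL (Fin n) ℂ)) hsym (hg.symm ▸ hL)
    rw [hf] at this
    exact this.unique hL
  obtain ⟨L, hL⟩ := exists_hasLogGrad hf.1 (g : GL (Fin n) ℂ)
  obtain ⟨M, hM⟩ := exists_hasLogGrad hh.1 (g : GL (Fin n) ℂ)
  refine ((isFixedBy_formGroup hanti hsym).stdBracket_eq (g := g) hL hM).trans ?_
  rw [average_of_fixed (hfix hf.2 hL), average_of_fixed (hfix hh.2 hM)]
  exact (stdBracketGL_eq hL hM).symm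

theorem isInducedBracket_formGroup
    (hanti : ∀ i j : Fin n, j ≠ i.rev → (Ω : Matrix (Fin n) (Fin n) ℂ) i j = 0)
    (hsym : (Ω : Matrix (Fin n) (Fin n) ℂ)ᵀ = (Ω : Matrix (Fin n) (Fin n) ℂ) ∨
        (Ω : Matrix (Fin n) (Fin n) ℂ)ᵀ = -(Ω : Matrix (Fin n) (Fin n) ℂ)) :
    IsInducedBracket (regularGL n) (stdBracketGL n) (tau Ω)
      (formGroup Ω : Set (GL (Fin n) ℂ)) (stdBracket (formGroup Ω)) := by
  have hclosed : ∀ f ∈ invariants (regularGL n) (tau Ω),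
      ∀ h ∈ invariants (regularGL n) (tau Ω),
      stdBracketGL n f h ∈ invariants (regularGL n) (tau Ω) := fun f hf h hh =>
    ⟨stdBracketGL_mem hf.1 hh.1, by
      rw [← (isPoissonInvolution_tau hanti hsym).map_bracket f hf.1 h hh.1, hf.2, hh.2]⟩
  have hzero : (0 : GL (Fin n) ℂ → ℂ) ∈ invariants (regularGL n) (tau Ω) := ⟨zero_mem _, rfl⟩
  have hideal : ∀ f ∈ invariants (regularGL n) (tau Ω),
      ∀ h ∈ invariants (regularGL n) (tau Ω),
      restrict (formGroup Ω : Set (GL (Fin n) ℂ)) f = 0 →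
      restrict (formGroup Ω : Set (GL (Fin n) ℂ)) (stdBracketGL n f h) = 0 :=
    fun f hf h hh h0 => by
      -- The bracket on $G(\Omega)$ sees only restrictions, so $f$ may be replaced by the invariant
      -- function $0$.
      rw [← stdBracket_formGroup_restrict hanti hsym hf hh, h0,
        ← map_zero (restrict (formGroup Ω : Set (GL (Fin n) ℂ))),
        stdBracket_formGroup_restrict hanti hsym hzero hh]
      congr 1
      simpa using stdBracketGL_const_left 0 hh.1
  refine ⟨mem_formGroup_iff Ω, hclosed, fun f hf h hh h0 => ⟨hideal f hf h hh h0, ?_⟩, ?_,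
    fun f hf h hh => stdBracket_formGroup_restrict hanti hsym hf hh⟩
  · rw [stdBracketGL_skew hh.1 hf.1, map_neg, hideal f hf h hh h0, neg_zero]
  · rintro _ ⟨f, hf, rfl⟩
    -- Averaging any extension over $\tau$ makes it invariant without changing its values on
    -- $G(\Omega)$.
    refine ⟨(1 / 2 : ℂ) • (f + f ∘ tau Ω),
      ⟨(regularGL n).smul_mem (add_mem hf (comp_tau_mem Ω hf)) _, ?_⟩, ?_⟩
    · funext g
      simp only [Function.comp_apply, Pi.smul_apply, Pi.add_apply, tau_tau hsym, add_comm]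
    · funext g
      have hg : tau Ω (g : GL (Fin n) ℂ) = g := (mem_formGroup_iff Ω _).mp g.2
      change (1 / 2 : ℂ) * (f g + f (tau Ω g)) = f g
      rw [hg]
      ring

end Main

end StdPoisson

end

theorem mainTheorem7 (n : ℕ) (Ω : GL (Fin n) ℂ)
    (hanti : ∀ i j : Fin n, j ≠ i.rev → (Ω : Matrix (Fin n) (Fin n) ℂ) i j = 0)
    (hsym : (Ω : Matrix (Fin n) (Fin n) ℂ)ᵀ = (Ω : Matrix (Fin n) (Fin n) ℂ) ∨
      (Ω : Matrix (Fin n) (Fin n) ℂ)ᵀ = -(Ω : Matrix (Fin n) (Fin n) ℂ)) :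
    -- the standard brackets on `GL_n` and on `G(Ω)` are well defined and are Poisson brackets
    StdPoisson.HasStandardData (⊤ : Subgroup (GL (Fin n) ℂ)) ∧
    StdPoisson.HasStandardData (StdPoisson.formGroup Ω) ∧
    StdPoisson.IsPoissonBracket (StdPoisson.regularGL n) (StdPoisson.stdBracketGL n) ∧
    StdPoisson.IsPoissonBracket (StdPoisson.regularOn (StdPoisson.formGroup Ω))
      (StdPoisson.stdBracket (StdPoisson.formGroup Ω)) ∧
    -- `τ` is an involution that preserves the standard Poisson structure on `GL_n`
    StdPoisson.IsPoissonInvolution (StdPoisson.regularGL n) (StdPoisson.stdBracketGL n)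
      (StdPoisson.tau Ω) ∧
    -- its fixed point set is `G(Ω)`, where it induces the standard Poisson structure
    StdPoisson.IsInducedBracket (StdPoisson.regularGL n) (StdPoisson.stdBracketGL n)
      (StdPoisson.tau Ω) (StdPoisson.formGroup Ω : Set (GL (Fin n) ℂ))
      (StdPoisson.stdBracket (StdPoisson.formGroup Ω)) :=
  ⟨StdPoisson.isFixedBy_top.hasStandardData,
    (StdPoisson.isFixedBy_formGroup hanti hsym).hasStandardData,
    StdPoisson.isPoissonBracket_GL,
    (StdPoisson.isInducedBracket_formGroup hanti hsym).isPoissonBracket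
      StdPoisson.isPoissonBracket_GL,
    StdPoisson.isPoissonInvolution_tau hanti hsym,
    StdPoisson.isInducedBracket_formGroup hanti hsym⟩
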